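/- A deck with multiplicities $\mathbf m=(m_1,\dots,m_n)$ is a word of length $N=\sum_{i=1}^n m_i$ in the letters (types) $\{1,\dots,n\}$ in which type $i$ occurs exactly $m_i$ times. Put $m=N/n$, $m^*=\max_i m_i$, and $$\beta_k=\frac1n\sum_{i=1}^n\frac1{m^k}\binom{m_i}{k}.$$ Let $\mathbf Z=(Z_1,\dots,Z_N)$ be a uniformly random deck with multiplicities $\mathbf m$, and let $$W_j(t)=\bigl|\{1\le s_1<\dots<s_{j+1}\le t:\ Z_{s_1}=\dots=Z_{s_{j+1}}\}\bigr|.$$ Theorem. For every integer $j\ge 1$ and every $\epsilon>0$ there is a constant $C$, depending only on $j$ and $\epsilon$, such that the following holds for all $n$, all $\mathbf m$ and all integers $t$ with $j\le m^*-1$ and $1\le t\le N$. Assume that $m\ge\epsilon m^*$ and that the fraction of cards whose type has multiplicity at least $\min(2j+1,m^*)$ is at least $\epsilon$, or that $m\ge\epsilon m^*$ and the fraction of types that have multiplicity at least $\min(2j+1,m^*)$ is at least $\epsilon$. Let $$\lambda=\frac{t^{j+1}}{n^j}\,\beta_{j+1},$$ and let $P$ be a Poisson random variable of mean $\lambda$.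 Then $$d_{TV}(W_j(t),P)\le C\,\frac tn,$$ where $d_{TV}(X,Y)=\sup_A|\mathbb P(X\in A)-\mathbb P(Y\in A)|$ is the total variation distance between the laws of $X$ and $Y$. -/

import Mathlib

open MeasureTheory ProbabilityTheory
open scoped NNReal

namespace CardDeck

/-- Total number `N` of cards of a deck with multiplicities `m`. -/
def size {n : ℕ} (m : Fin n → ℕ) : ℕ := ∑ i, m i

/-- Largest multiplicity `m*`. -/
def maxMult {n : ℕ} (m : Fin n → ℕ) : ℕ := Finset.univ.sup m

/-- Average multiplicity `N / n`. -/
noncomputable def avgMult {n : ℕ} (m : Fin n → ℕ) : ℝ≥0 := (size m : ℝ≥0) / (n : ℝ≥0)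

/-- `β_j = (1 / n) ∑ i, (m i choose j) / (N / n) ^ j`. -/
noncomputable def beta {n : ℕ} (m : Fin n → ℕ) (j : ℕ) : ℝ≥0 :=
  (1 / (n : ℝ≥0)) * ∑ i, (1 / avgMult m ^ j) * ((m i).choose j : ℝ≥0)

/-- The proportion of the `N` cards whose type has multiplicity at least `k`. -/
noncomputable def cardFraction {n : ℕ} (m : Fin n → ℕ) (k : ℕ) : ℝ :=
  ((∑ i with k ≤ m i, m i : ℕ) : ℝ) / (size m : ℝ)

/-- The proportion of the `n` types which have multiplicity at least `k`. -/
noncomputable def typeFraction {n : ℕ} (m : Fin n → ℕ) (k : ℕ) : ℝ :=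
  ((Finset.univ.filter fun i => k ≤ m i).card : ℝ) / (n : ℝ)

/-- The decks with multiplicities `m`: words of length `N` in the letters `Fin n` in which
each letter `i` occurs exactly `m i` times. -/
def decks {n : ℕ} (m : Fin n → ℕ) : Set (Fin (size m) → Fin n) :=
  {z | ∀ i, (Finset.univ.filter fun s => z s = i).card = m i}

/-- The law of a thoroughly shuffled deck: the uniform distribution on `decks m`. -/
noncomputable def shuffledDeck {n : ℕ} (m : Fin n → ℕ) : Measure (Fin (size m) → Fin n) :=
  uniformOn (decks m)

/-- The number of `(j + 1)`-element sets of positions among the first `t` cards of `z`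
(positions are numbered from `0`) that carry cards of one and the same type. -/
def W {n N : ℕ} (j t : ℕ) (z : Fin N → Fin n) : ℕ :=
  (Finset.univ.filter fun s : Finset (Fin N) =>
    s.card = j + 1 ∧ (∀ a ∈ s, (a : ℕ) < t) ∧ ∀ a ∈ s, ∀ b ∈ s, z a = z b).card

/-- The law of `W j t` for a thoroughly shuffled deck with multiplicities `m`. -/
noncomputable def lawW {n : ℕ} (m : Fin n → ℕ) (j t : ℕ) : Measure ℕ :=
  (shuffledDeck m).map (W j t)

/-- Total variation distance of two probability measures, `sup_A |μ(A) - ν(A)|` over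
measurable sets `A`; for probability measures the supremum is over a set bounded by `1`. -/
noncomputable def tvDist {Ω : Type*} [MeasurableSpace Ω] (μ ν : Measure Ω) : ℝ :=
  ⨆ A : {A : Set Ω // MeasurableSet A}, |μ.real A - ν.real A|

theorem decks_nonempty {n : ℕ} (m : Fin n → ℕ) : (decks m).Nonempty := by
  let e : (Σ i : Fin n, Fin (m i)) ≃ Fin (size m) := finSigmaFinEquiv
  refine ⟨fun s => (e.symm s).1, fun i => ?_⟩
  rw [← Fintype.card_subtype, ← Fintype.card_fin (m i)]
  refine Fintype.card_congr ((e.symm.subtypeEquiv fun _ => Iff.rfl).trans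
    (Equiv.sigmaSubtype (β := fun i => Fin (m i)) i))

instance shuffledDeck_isProbabilityMeasure {n : ℕ} (m : Fin n → ℕ) :
    IsProbabilityMeasure (shuffledDeck m) :=
  isProbabilityMeasure_uniformOn (Set.toFinite _) (decks_nonempty m)

instance lawW_isProbabilityMeasure {n : ℕ} (m : Fin n → ℕ) (j t : ℕ) :
    IsProbabilityMeasure (lawW m j t) :=
  Measure.isProbabilityMeasure_map (measurable_of_finite _).aemeasurable

end CardDeck

namespace CardDeck

/-! ### The Poisson distribution: comparison of rates and Stein's equation -/

/-! By exchangeability, the count in the first `t` cards of a random deck has the law of the number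
of monochromatic `(j+1)`-sets of one fixed deck that lie in a uniformly random `t`-set `S` of
positions (`lawW_real_eq_avg`). So the task is a Poisson approximation for the number `W` of members
of a family `F` of `r`-sets contained in `S`, with `r = j + 1`.

This is the Stein–Chen method with a size-bias coupling. With `μ = E W`, `E[W f(W)]` is the sum over
`B ∈ F` of `P(B ⊆ S) E[f(W) | B ⊆ S]`, to be compared with `μ E[f(W + 1)]`. Conditioning on `B ⊆ S`
is realised by inserting the elements of `B` one at a time, each replacing a uniformly chosen
element of `S` (`sum_sum_replaceBy`). A swap destroys few members of `F`, since each has only `r` of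
about `t` elements, and creates only members meeting `B`. The increments of the Stein solution are
at most `1 / μ` (`exists_stein_solution`), which cancels against the sum of the `P(B ⊆ S)`, so the
total error is an average of the errors for single `B`.

With `y = t / N`, clustering is measured by the sum of `y ^ |B' \ B|` over `B' ≠ B` meeting `B`. For
monochromatic sets it is at most `2 ^ r ((1 + y) ^ m* - 1)`, which is `O(t / n)` when `t ≤ n`,
because `m ≥ ε m*` gives `m* y ≤ t / (ε n)`. Replacing `μ` by `λ` costs `O(λ / t)`, again `O(t /
n)`. For `t > n` the claim is trivial. -/

theorem hasSum_indicator_poissonMeasure (r : ℝ≥0) (A : Set ℕ) :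
    HasSum (A.indicator fun k => (poissonMeasure r).real {k}) ((poissonMeasure r).real A) := by
  have h : Integrable (A.indicator (1 : ℕ → ℝ)) (poissonMeasure r) :=
    (integrable_const (1 : ℝ)).indicator (MeasurableSet.of_discrete)
  have h' := hasSum_integral_poissonMeasure h
  rw [integral_indicator_one MeasurableSet.of_discrete] at h'
  have e : (A.indicator fun k => (poissonMeasure r).real {k})
      = fun k => (Real.exp (-r) * r ^ k / k.factorial) • A.indicator (1 : ℕ → ℝ) k := by
    funext k
    by_cases hk : k ∈ A <;> simp [hk, poissonMeasure_real_singleton]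
  rw [e]
  exact h'

theorem poissonMeasure_real_singleton_succ (r : ℝ≥0) (k : ℕ) :
    ((k : ℝ) + 1) * (poissonMeasure r).real {k + 1} = r * (poissonMeasure r).real {k} := by
  rw [poissonMeasure_real_singleton, poissonMeasure_real_singleton, Nat.factorial_succ]
  push_cast
  field_simp
  ring

/-- Termwise, the exponentials combine to `exp (-b)` and `a ^ k ≤ b ^ k`. -/
theorem exp_mul_poissonMeasure_real_le {a b : ℝ≥0} (hab : a ≤ b) (A : Set ℕ) :
    Real.exp (-((b : ℝ) - a)) * (poissonMeasure a).real A ≤ (poissonMeasure b).real A := by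
  refine hasSum_le (fun k => ?_) ((hasSum_indicator_poissonMeasure a A).mul_left _)
    (hasSum_indicator_poissonMeasure b A)
  by_cases hk : k ∈ A
  · simp only [Set.indicator_of_mem hk, poissonMeasure_real_singleton]
    rw [← mul_div_assoc, ← mul_assoc, ← Real.exp_add]
    have : -((b : ℝ) - a) + -a = -b := by ring
    rw [this]
    have h : (a : ℝ) ≤ b := by exact_mod_cast hab
    gcongr
  · simp [hk]

theorem abs_poissonMeasure_real_sub_le (a b : ℝ≥0) (A : Set ℕ) :
    |(poissonMeasure a).real A - (poissonMeasure b).real A| ≤ |(a : ℝ) - b| := by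
  wlog hab : a ≤ b generalizing a b
  · rw [abs_sub_comm, abs_sub_comm (a : ℝ)]
    exact this b a (le_of_not_ge hab)
  have hab' : (a : ℝ) ≤ b := by exact_mod_cast hab
  have key : ∀ A : Set ℕ,
      (poissonMeasure a).real A - (poissonMeasure b).real A ≤ (b : ℝ) - a := by
    intro A
    have h1 := exp_mul_poissonMeasure_real_le hab A
    have h2 := Real.add_one_le_exp (-((b : ℝ) - a))
    have h3 : (poissonMeasure a).real A ≤ 1 := measureReal_le_one
    have h4 : 0 ≤ (poissonMeasure a).real A := measureReal_nonneg
    nlinarith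
  rw [abs_sub_comm (a : ℝ), abs_of_nonneg (sub_nonneg.2 hab'), abs_le]
  refine ⟨?_, key A⟩
  -- The reverse inequality is the same one for the complement.
  have h := key Aᶜ
  rw [probReal_compl_eq_one_sub MeasurableSet.of_discrete,
    probReal_compl_eq_one_sub MeasurableSet.of_discrete] at h
  linarith

/-- The increment of the solution of Stein's equation, in terms of the masses `a ≤ F` below,
`δ p` at, and `b ≤ G` above a point `k`. -/
theorem stein_increment_bound {a F b G p δ r k : ℝ} (hr : 0 < r) (hk : 0 < k) (hp : 0 < p)
    (ha : 0 ≤ a) (haF : a ≤ F) (hb : 0 ≤ b) (hbG : b ≤ G) (hδ : 0 ≤ δ) (hδ1 : δ ≤ 1)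
    (h1 : F + p + G = 1) (hG : k * G ≤ r * (G + p)) (hF : r * F ≤ k * (F + p)) :
    |((a + δ * p) * G - b * (F + p)) / (r * p) - (a * (G + p) - (b + δ * p) * F) / (k * p)|
      ≤ 1 / r := by
  have e : ((a + δ * p) * G - b * (F + p)) / (r * p)
      - (a * (G + p) - (b + δ * p) * F) / (k * p)
      = (k * ((a + δ * p) * G - b * (F + p)) - r * (a * (G + p) - (b + δ * p) * F))
        / (k * p) / r := by
    field_simp
  rw [e, abs_div, abs_of_pos hr, abs_div, abs_of_pos (mul_pos hk hp)]
  refine div_le_div_of_nonneg_right ?_ hr.le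
  rw [div_le_one (mul_pos hk hp)]
  -- Both subtracted terms are nonnegative, and together at most `p * (k * G + r * F)`, the value at
  -- `a = F`, `b = G`. Hence everything lies within `p * (k * G + r * F) ≤ k * p` of zero.
  have e2 : k * ((a + δ * p) * G - b * (F + p)) - r * (a * (G + p) - (b + δ * p) * F)
      = δ * p * (k * G + r * F) - a * (r * (G + p) - k * G) - b * (k * (F + p) - r * F) := by
    ring
  have n1 : 0 ≤ a * (r * (G + p) - k * G) := mul_nonneg ha (by linarith)
  have n2 : 0 ≤ b * (k * (F + p) - r * F) := mul_nonneg hb (by linarith)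
  have n3 : a * (r * (G + p) - k * G) ≤ F * (r * (G + p) - k * G) :=
    mul_le_mul_of_nonneg_right haF (by linarith)
  have n4 : b * (k * (F + p) - r * F) ≤ G * (k * (F + p) - r * F) :=
    mul_le_mul_of_nonneg_right hbG (by linarith)
  have m0 : 0 ≤ p * (k * G + r * F) := by
    have := mul_nonneg hr.le (ha.trans haF)
    have := mul_nonneg hk.le (hb.trans hbG)
    exact mul_nonneg hp.le (by linarith)
  have m1 : δ * p * (k * G + r * F) ≤ p * (k * G + r * F) := by
    rw [mul_assoc]; exact mul_le_of_le_one_left m0 hδ1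
  have m2 : 0 ≤ δ * p * (k * G + r * F) := by rw [mul_assoc]; exact mul_nonneg hδ m0
  have m3 : p * (k * G + r * F) ≤ k * p := by
    have : k * G + r * F ≤ k := by
      calc k * G + r * F ≤ k * (F + p + G) := by linarith
        _ = k := by rw [h1, mul_one]
    nlinarith
  rw [e2, abs_le]
  constructor
  · have : F * (r * (G + p) - k * G) + G * (k * (F + p) - r * F) = p * (k * G + r * F) := by ring
    linarith
  · linarith

/-- Sum `r p_i = (i + 1) p_{i+1} ≤ k p_{i+1}` over `i < k`. The companion bound for `Set.Ioi` sums
the opposite inequality over `i ≥ k`. -/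
theorem mul_poissonMeasure_real_Iio_le (r : ℝ≥0) (k : ℕ) :
    (r : ℝ) * (poissonMeasure r).real (Set.Iio k)
      ≤ k * ((poissonMeasure r).real (Set.Iio k) + (poissonMeasure r).real {k}) := by
  have hs : ∀ k : ℕ, (poissonMeasure r).real (Set.Iio k)
      = ∑ i ∈ Finset.range k, (poissonMeasure r).real {i} := by
    intro k
    rw [sum_measureReal_singleton, Finset.coe_range]
  rw [hs, ← Finset.sum_range_succ, Finset.sum_range_succ', mul_add, Finset.mul_sum,
    Finset.mul_sum]
  refine le_add_of_le_of_nonneg (Finset.sum_le_sum fun i hi => ?_)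
    (mul_nonneg k.cast_nonneg measureReal_nonneg)
  rw [← poissonMeasure_real_singleton_succ]
  have : (i : ℝ) + 1 ≤ k := by exact_mod_cast Finset.mem_range.1 hi
  gcongr

theorem mul_poissonMeasure_real_Ioi_le (r : ℝ≥0) (k : ℕ) :
    (k : ℝ) * (poissonMeasure r).real (Set.Ioi k)
      ≤ r * (poissonMeasure r).real (Set.Ici k) := by
  have h1 := (hasSum_indicator_poissonMeasure r (Set.Ioi k)).mul_left (k : ℝ)
  have h2 := (hasSum_indicator_poissonMeasure r (Set.Ici k)).mul_left (r : ℝ)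
  rw [← hasSum_nat_add_iff' 1] at h1
  simp only [Finset.range_one, Finset.sum_singleton, Set.mem_Ioi, not_lt_zero, not_false_eq_true,
    Set.indicator_of_notMem, mul_zero, sub_zero] at h1
  refine hasSum_le (fun i => ?_) h1 h2
  by_cases hi : k ≤ i
  · rw [Set.indicator_of_mem (Set.mem_Ici.2 hi), Set.indicator_of_mem
      (Set.mem_Ioi.2 (Nat.lt_succ_of_le hi)), ← poissonMeasure_real_singleton_succ]
    have : (k : ℝ) ≤ i + 1 := by exact_mod_cast hi.trans i.le_succ
    gcongr
  · rw [Set.indicator_of_notMem (by simpa using hi), Set.indicator_of_notMem (by simp; omega)]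
    simp

/-- **Stein's equation** for the Poisson distribution of rate `r`, with a solution whose
increments are at most `1 / r`. -/
theorem exists_stein_solution {r : ℝ≥0} (hr : 0 < r) (A : Set ℕ) :
    ∃ f : ℕ → ℝ,
      (∀ k : ℕ, (r : ℝ) * f (k + 1) - k * f k
        = A.indicator 1 k - (poissonMeasure r).real A) ∧
      ∀ k l : ℕ, |f (k + 1) - f (l + 1)| ≤ 1 / r * |(k : ℝ) - l| := by
  have hr' : (0 : ℝ) < r := by exact_mod_cast hr
  set P : Set ℕ → ℝ := (poissonMeasure r).real with hP
  have hp : ∀ k, 0 < P {k} := fun k => poissonMeasure_real_singleton_pos k hr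
  -- Multiplied by `P {k}`, Stein's equation telescopes, and `g k` is the partial sum of its
  -- right-hand side.
  let g : ℕ → ℝ := fun k => P (A ∩ Set.Iio k) - P A * P (Set.Iio k)
  have hIio : ∀ k, P (Set.Iio (k + 1)) = P (Set.Iio k) + P {k} := by
    intro k
    rw [show Set.Iio (k + 1) = Set.Iio k ∪ {k} by ext; simp]
    exact measureReal_union (by simp) MeasurableSet.of_discrete
  have hAIio : ∀ k, P (A ∩ Set.Iio (k + 1))
      = P (A ∩ Set.Iio k) + A.indicator 1 k * P {k} := by
    intro k
    by_cases hk : k ∈ A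
    · rw [show A ∩ Set.Iio (k + 1) = (A ∩ Set.Iio k) ∪ {k} by
        ext x; simp only [Set.mem_inter_iff, Set.mem_Iio, Set.mem_union, Set.mem_singleton_iff]
        constructor
        · rintro ⟨h, h'⟩
          rcases Nat.lt_succ_iff_lt_or_eq.1 h' with h'' | h''
          · exact Or.inl ⟨h, h''⟩
          · exact Or.inr h''
        · rintro (⟨h, h'⟩ | rfl)
          · exact ⟨h, by omega⟩
          · exact ⟨hk, by omega⟩, Set.indicator_of_mem hk, Pi.one_apply, one_mul]
      exact measureReal_union (by simp) MeasurableSet.of_discrete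
    · rw [Set.indicator_of_notMem hk, zero_mul, add_zero]
      congr 1
      ext x
      simp only [Set.mem_inter_iff, Set.mem_Iio]
      refine and_congr_right fun h => ⟨fun h' => ?_, fun h' => by omega⟩
      have : x ≠ k := fun h'' => hk (h'' ▸ h)
      omega
  have hg : ∀ k, g (k + 1) - g k = (A.indicator 1 k - P A) * P {k} := by
    intro k
    simp only [g, hIio, hAIio]
    ring
  have hstep : ∀ k : ℕ, ((k : ℝ) + 1) * P {k + 1} = r * P {k} :=
    poissonMeasure_real_singleton_succ r
  -- The value at `0` is a division by zero; it is immaterial, since `f 0` enters only through `0 *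
  -- f 0`.
  let f : ℕ → ℝ := fun k => g k / (k * P {k})
  have hf1 : ∀ k : ℕ, f (k + 1) = g (k + 1) / (r * P {k}) := by
    intro k
    simp only [f]
    push_cast
    rw [hstep]
  have heq : ∀ k : ℕ, (r : ℝ) * f (k + 1) - k * f k = A.indicator 1 k - P A := by
    intro k
    have h0 : (k : ℝ) * f k = g k / P {k} := by
      rcases Nat.eq_zero_or_pos k with rfl | hk
      · simp [g, hP]
      · have : (k : ℝ) ≠ 0 := by positivity
        have := (hp k).ne'
        simp only [f]
        field_simp
    have h1 := (hp k).ne'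
    rw [h0, hf1, eq_comm, eq_sub_iff_add_eq]
    field_simp
    linarith [hg k]
  have hincr : ∀ k : ℕ, |f (k + 1 + 1) - f (k + 1)| ≤ 1 / r := by
    intro k
    have hA : P A = P (A ∩ Set.Iio (k + 1)) + A.indicator 1 (k + 1) * P {k + 1}
        + P (A ∩ Set.Ioi (k + 1)) := by
      rw [← hAIio, ← measureReal_union _ MeasurableSet.of_discrete]
      · congr 1
        ext x; simp only [Set.mem_union, Set.mem_inter_iff, Set.mem_Iio, Set.mem_Ioi]
        have : x < k + 1 + 1 ∨ k + 1 < x := by omega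
        tauto
      · rw [Set.disjoint_left]
        intro x; simp only [Set.mem_inter_iff, Set.mem_Iio, Set.mem_Ioi]
        omega
    have h1 : P (Set.Iio (k + 1)) + P {k + 1} + P (Set.Ioi (k + 1)) = 1 := by
      rw [← hIio, ← measureReal_union _ MeasurableSet.of_discrete, ← probReal_univ (μ := poissonMeasure r)]
      · congr 1
        ext x; simp; omega
      · rw [Set.disjoint_left]
        intro x; simp only [Set.mem_Iio, Set.mem_Ioi]
        omega
    have hIci : P (Set.Ici (k + 1)) = P (Set.Ioi (k + 1)) + P {k + 1} := by
      rw [show Set.Ici (k + 1) = Set.Ioi (k + 1) ∪ {k + 1} by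
        ext; simp only [Set.mem_Ici, Set.mem_union, Set.mem_Ioi, Set.mem_singleton_iff]; omega]
      exact measureReal_union (by simp) MeasurableSet.of_discrete
    have hG := mul_poissonMeasure_real_Ioi_le r (k + 1)
    have hF := mul_poissonMeasure_real_Iio_le r (k + 1)
    rw [← hP, hIci] at hG
    have hδ : A.indicator (1 : ℕ → ℝ) (k + 1) = 0 ∨ A.indicator (1 : ℕ → ℝ) (k + 1) = 1 := by
      by_cases h : k + 1 ∈ A <;> simp [h]
    have key := stein_increment_bound (a := P (A ∩ Set.Iio (k + 1))) (F := P (Set.Iio (k + 1)))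
      (b := P (A ∩ Set.Ioi (k + 1))) (G := P (Set.Ioi (k + 1))) (p := P {k + 1})
      (δ := A.indicator 1 (k + 1)) (r := r) (k := ((k + 1 : ℕ) : ℝ)) hr' (by positivity) (hp _)
      measureReal_nonneg (measureReal_mono Set.inter_subset_right) measureReal_nonneg
      (measureReal_mono Set.inter_subset_right) (by rcases hδ with h | h <;> simp [h])
      (by rcases hδ with h | h <;> simp [h]) h1 hG hF
    have e1 : g (k + 1 + 1) = (P (A ∩ Set.Iio (k + 1)) + A.indicator 1 (k + 1) * P {k + 1})
        * P (Set.Ioi (k + 1)) - P (A ∩ Set.Ioi (k + 1)) * (P (Set.Iio (k + 1)) + P {k + 1}) := by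
      have h2 : P (Set.Ioi (k + 1)) = 1 - P (Set.Iio (k + 1)) - P {k + 1} := by linarith
      simp only [g]
      rw [hAIio, hIio, hA, h2]
      ring
    have e2 : g (k + 1) = P (A ∩ Set.Iio (k + 1)) * (P (Set.Ioi (k + 1)) + P {k + 1})
        - (P (A ∩ Set.Ioi (k + 1)) + A.indicator 1 (k + 1) * P {k + 1}) * P (Set.Iio (k + 1)) := by
      have h2 : P (Set.Ioi (k + 1)) = 1 - P (Set.Iio (k + 1)) - P {k + 1} := by linarith
      simp only [g]
      rw [hA, h2]
      ring
    rw [← e1, ← e2] at key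
    rw [hf1 (k + 1)]
    exact key
  refine ⟨f, heq, fun k l => ?_⟩
  wlog hkl : l ≤ k generalizing k l
  · rw [abs_sub_comm, abs_sub_comm (k : ℝ)]
    exact this l k (le_of_not_ge hkl)
  have hkl' : (l : ℝ) ≤ k := by exact_mod_cast hkl
  rw [abs_of_nonneg (sub_nonneg.2 hkl')]
  induction k, hkl using Nat.le_induction with
  | base => simp
  | succ k hk ih =>
    have h1 := ih (by exact_mod_cast hk)
    have h2 := abs_sub_le (f (k + 1 + 1)) (f (k + 1)) (f (l + 1))
    have h3 := hincr k
    push_cast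
    have : 1 / (r : ℝ) * ((k : ℝ) + 1 - l) = 1 / r + 1 / r * (k - l) := by ring
    linarith

/-! ### Uniformly random sets of given size -/

section RandomSubset

variable {V : Type*} [Fintype V] [DecidableEq V]

/-- The `t`-element sets which contain `A`. -/
def supersets (t : ℕ) (A : Finset V) : Finset (Finset V) :=
  Finset.univ.filter fun S => S.card = t ∧ A ⊆ S

@[simp] theorem mem_supersets {t : ℕ} {A S : Finset V} :
    S ∈ supersets t A ↔ S.card = t ∧ A ⊆ S := by simp [supersets]

/-- Replace the element `x` of `S` by `b`, if `b` does not belong to `S` yet. -/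
def replaceBy (S : Finset V) (x b : V) : Finset V :=
  if b ∈ S then S else insert b (S.erase x)

/-- Average of `h` over the `t`-element sets which contain `A`. -/
noncomputable def avg (t : ℕ) (A : Finset V) (h : Finset V → ℝ) : ℝ :=
  (∑ S ∈ supersets t A, h S) / (supersets t A).card

theorem supersets_card_pos {t : ℕ} {A : Finset V} (hA : A.card ≤ t)
    (ht : t ≤ Fintype.card V) : 0 < (supersets t A).card := by
  obtain ⟨S, hAS, -, hS⟩ := Finset.exists_subsuperset_card_eq (Finset.subset_univ A) hA ht
  exact Finset.card_pos.2 ⟨S, by simp [hS, hAS]⟩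

/-- The coupling: a uniform superset of `A` with a uniform `x ∈ S \ A` replaced by `b` becomes a
uniform superset of `insert b A`. Each target `T` arises `t - |A|` times from `S = T`, and once for
each of the `|V| - t` elements `x ∉ T`, by undoing the swap. -/
theorem sum_sum_replaceBy (t : ℕ) {A : Finset V} {b : V} (hb : b ∉ A) (h : Finset V → ℝ) :
    ∑ S ∈ supersets t A, ∑ x ∈ S \ A, h (replaceBy S x b)
      = ((Fintype.card V : ℝ) - A.card) * ∑ S ∈ supersets t (insert b A), h S := by
  rw [← Finset.sum_filter_add_sum_filter_not _ (fun S => b ∈ S)]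
  have h1 : ∑ S ∈ (supersets t A).filter (fun S => b ∈ S), ∑ x ∈ S \ A, h (replaceBy S x b)
      = ∑ S ∈ supersets t (insert b A), ((t : ℝ) - A.card) * h S := by
    refine Finset.sum_congr ?_ fun S hS => ?_
    · ext S
      simp only [Finset.mem_filter, mem_supersets, Finset.insert_subset_iff]
      tauto
    · obtain ⟨hS1, hS2⟩ := mem_supersets.1 hS
      rw [Finset.insert_subset_iff] at hS2
      simp only [replaceBy, hS2.1, if_true, Finset.sum_const, nsmul_eq_mul]
      rw [Finset.card_sdiff_of_subset hS2.2, Nat.cast_sub (Finset.card_le_card hS2.2), hS1]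
  have h2 : ∑ S ∈ (supersets t A).filter (fun S => ¬ b ∈ S), ∑ x ∈ S \ A, h (replaceBy S x b)
      = ∑ S ∈ supersets t (insert b A), ((Fintype.card V : ℝ) - t) * h S := by
    have e : ∀ S ∈ supersets t (insert b A),
        ((Fintype.card V : ℝ) - t) * h S = ∑ x ∈ Sᶜ, h S := by
      intro S hS
      rw [Finset.sum_const, nsmul_eq_mul, Finset.card_compl, Nat.cast_sub (Finset.card_le_univ S),
        (mem_supersets.1 hS).1]
    rw [Finset.sum_congr rfl e, Finset.sum_sigma', Finset.sum_sigma']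
    refine Finset.sum_bij' (fun p _ => ⟨insert b (p.1.erase p.2), p.2⟩)
      (fun p _ => ⟨insert p.2 (p.1.erase b), p.2⟩) ?_ ?_ ?_ ?_ ?_
    · rintro ⟨S, x⟩ hp
      simp only [Finset.mem_sigma, Finset.mem_filter, mem_supersets, Finset.mem_sdiff] at hp
      obtain ⟨⟨⟨hS, hA⟩, hbS⟩, hxS, hxA⟩ := hp
      simp only [Finset.mem_sigma, mem_supersets, Finset.mem_compl]
      refine ⟨⟨?_, ?_⟩, ?_⟩
      · rw [Finset.card_insert_of_notMem (by simp [hbS]), Finset.card_erase_add_one hxS, hS]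
      · refine Finset.insert_subset_insert _ fun a ha => Finset.mem_erase.2 ⟨?_, hA ha⟩
        rintro rfl
        exact hxA ha
      · simp only [Finset.mem_insert, Finset.mem_erase, not_or]
        refine ⟨?_, by simp⟩
        rintro rfl
        exact hbS hxS
    · rintro ⟨S, x⟩ hp
      simp only [Finset.mem_sigma, mem_supersets, Finset.mem_compl, Finset.insert_subset_iff] at hp
      obtain ⟨⟨hS, hbS, hA⟩, hxS⟩ := hp
      simp only [Finset.mem_sigma, Finset.mem_filter, mem_supersets, Finset.mem_sdiff]
      refine ⟨⟨⟨?_, ?_⟩, ?_⟩, by simp, fun h => hxS (hA h)⟩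
      · rw [Finset.card_insert_of_notMem (by simp [hxS]), Finset.card_erase_add_one hbS, hS]
      · refine fun a ha => Finset.mem_insert_of_mem (Finset.mem_erase.2 ⟨?_, hA ha⟩)
        rintro rfl
        exact hb ha
      · simp only [Finset.mem_insert, Finset.mem_erase, not_or]
        refine ⟨?_, by simp⟩
        rintro rfl
        exact hxS hbS
    · rintro ⟨S, x⟩ hp
      simp only [Finset.mem_sigma, Finset.mem_filter, mem_supersets, Finset.mem_sdiff] at hp
      obtain ⟨⟨⟨hS, hA⟩, hbS⟩, hxS, hxA⟩ := hp
      simp only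
      rw [Finset.erase_insert (by simp [hbS]), Finset.insert_erase hxS]
    · rintro ⟨S, x⟩ hp
      simp only [Finset.mem_sigma, mem_supersets, Finset.mem_compl, Finset.insert_subset_iff] at hp
      obtain ⟨⟨hS, hbS, hA⟩, hxS⟩ := hp
      simp only
      rw [Finset.erase_insert (by simp [hxS]), Finset.insert_erase hbS]
    · rintro ⟨S, x⟩ hp
      simp only [Finset.mem_sigma, Finset.mem_filter] at hp
      simp [replaceBy, hp.1.2]
  rw [h1, h2, ← Finset.sum_add_distrib, Finset.mul_sum]
  exact Finset.sum_congr rfl fun S _ => by ring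

theorem supersets_card_insert (t : ℕ) {A : Finset V} {b : V} (hb : b ∉ A) :
    ((t : ℝ) - A.card) * (supersets t A).card
      = ((Fintype.card V : ℝ) - A.card) * (supersets t (insert b A)).card := by
  have h := sum_sum_replaceBy t hb fun _ => 1
  rw [Finset.sum_const, nsmul_eq_mul, mul_one] at h
  rw [← h, mul_comm, ← nsmul_eq_mul, ← Finset.sum_const]
  refine Finset.sum_congr rfl fun S hS => ?_
  obtain ⟨hS1, hS2⟩ := mem_supersets.1 hS
  rw [Finset.sum_const, nsmul_eq_mul, mul_one, Finset.card_sdiff_of_subset hS2,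
    Nat.cast_sub (Finset.card_le_card hS2), hS1]

theorem card_lt_of_notMem {U : Type*} [Fintype U] {A : Finset U} {b : U} (hb : b ∉ A) :
    (A.card : ℝ) < Fintype.card U := by
  exact_mod_cast Finset.card_lt_univ_of_notMem hb

theorem supersets_card_insert_le {t : ℕ} (ht : t ≤ Fintype.card V) {A : Finset V} {b : V}
    (hb : b ∉ A) : ((supersets t (insert b A)).card : ℝ)
      ≤ (t : ℝ) / Fintype.card V * (supersets t A).card := by
  have h := supersets_card_insert t hb
  have hlt := card_lt_of_notMem hb
  have hN : (0 : ℝ) < Fintype.card V := (Nat.cast_nonneg _).trans_lt hlt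
  have ht' : (t : ℝ) ≤ Fintype.card V := by exact_mod_cast ht
  have hc : (0 : ℝ) ≤ (supersets t A).card := Nat.cast_nonneg _
  rw [div_mul_eq_mul_div, le_div_iff₀ hN]
  refine le_of_mul_le_mul_left ?_ (sub_pos.2 hlt)
  rw [← mul_assoc, ← h]
  have h0 : (0 : ℝ) ≤ A.card := Nat.cast_nonneg _
  have : ((t : ℝ) - A.card) * Fintype.card V ≤ ((Fintype.card V : ℝ) - A.card) * t := by nlinarith
  calc ((t : ℝ) - A.card) * (supersets t A).card * Fintype.card V
      = ((t : ℝ) - A.card) * Fintype.card V * (supersets t A).card := by ring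
    _ ≤ ((Fintype.card V : ℝ) - A.card) * t * (supersets t A).card := by gcongr
    _ = _ := by ring

/-- Each new element costs a factor `(t - k) / (|V| - k) ≤ t / |V|`, with `k` the number of elements
already prescribed. -/
theorem supersets_card_union_le {t : ℕ} (ht : t ≤ Fintype.card V) (A Q : Finset V) :
    ((supersets t (A ∪ Q)).card : ℝ)
      ≤ ((t : ℝ) / Fintype.card V) ^ (Q \ A).card * (supersets t A).card := by
  induction Q using Finset.induction_on with
  | empty => simp
  | insert q Q hq ih =>
    by_cases hqA : q ∈ A
    · rw [Finset.union_insert, Finset.insert_eq_of_mem (Finset.mem_union_left _ hqA),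
        Finset.insert_sdiff_of_mem _ hqA]
      exact ih
    · rw [Finset.union_insert, Finset.insert_sdiff_of_notMem _ hqA,
        Finset.card_insert_of_notMem (by simp [hq]), pow_succ']
      refine (supersets_card_insert_le ht (by simp [hq, hqA])).trans ?_
      rw [mul_assoc]
      gcongr

theorem le_supersets_card {t : ℕ} (ht0 : 0 < t) (A : Finset V) :
    (1 - (A.card : ℝ) ^ 2 / t) * ((t : ℝ) / Fintype.card V) ^ A.card
        * (supersets t (∅ : Finset V)).card ≤ (supersets t A).card := by
  have ht' : (0 : ℝ) < t := by exact_mod_cast ht0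
  induction A using Finset.induction_on with
  | empty => simp
  | insert b A hb ih =>
    rw [Finset.card_insert_of_notMem hb]
    push_cast
    set k : ℝ := (A.card : ℝ) with hk
    have hk0 : 0 ≤ k := Nat.cast_nonneg _
    have hlt := card_lt_of_notMem hb
    have hN : (0 : ℝ) < Fintype.card V := (Nat.cast_nonneg _).trans_lt hlt
    have h := supersets_card_insert t hb
    set N : ℝ := (Fintype.card V : ℝ) with hNdef
    set c : ℝ := ((supersets t (∅ : Finset V)).card : ℝ) with hc
    have hc0 : 0 ≤ c := Nat.cast_nonneg _
    rcases le_or_gt k t with hkt | hkt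
    · have h1 : (t - k) / N * (supersets t A).card ≤ (supersets t (insert b A)).card := by
        rw [div_mul_eq_mul_div, div_le_iff₀ hN, h, mul_comm]
        gcongr
        linarith
      refine le_trans ?_ h1
      refine le_trans ?_ (mul_le_mul_of_nonneg_left ih (div_nonneg (sub_nonneg.2 hkt) hN.le))
      have h2 : (t - k) / N = (1 - k / t) * (t / N) := by field_simp
      -- The induction loses `k / t` per element; `(k + 1) ^ 2` leaves room for `k ^ 2 + k`.
      have h3 : 1 - (k + 1) ^ 2 / t ≤ (1 - k / t) * (1 - k ^ 2 / t) := by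
        have : (1 - k / t) * (1 - k ^ 2 / t) = 1 - (k + 1) ^ 2 / t
            + ((k + 1) / t + k * k ^ 2 / (t * t)) := by field_simp; ring
        rw [this]
        have : 0 ≤ (k + 1) / t + k * k ^ 2 / (t * t) := by positivity
        linarith
      calc (1 - (k + 1) ^ 2 / t) * (t / N) ^ (A.card + 1) * c
          ≤ (1 - k / t) * (1 - k ^ 2 / t) * (t / N) ^ (A.card + 1) * c := by gcongr
        _ = (t - k) / N * ((1 - k ^ 2 / t) * (t / N) ^ A.card * c) := by rw [h2]; ring
    · refine le_trans (mul_nonpos_of_nonpos_of_nonneg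
        (mul_nonpos_of_nonpos_of_nonneg ?_ (by positivity)) hc0) (Nat.cast_nonneg _)
      rw [sub_nonpos, one_le_div ht']
      nlinarith

theorem avg_insert {t : ℕ} (ht : t ≤ Fintype.card V) {A : Finset V} {b : V} (hb : b ∉ A)
    (hA : A.card < t) (h : Finset V → ℝ) :
    avg t (insert b A) h = (∑ S ∈ supersets t A, ∑ x ∈ S \ A, h (replaceBy S x b))
      / (((t : ℝ) - A.card) * (supersets t A).card) := by
  have hN := card_lt_of_notMem hb
  have hc : (0 : ℝ) < (supersets t (insert b A)).card := by
    exact_mod_cast supersets_card_pos (by rw [Finset.card_insert_of_notMem hb]; omega) ht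
  rw [supersets_card_insert t hb, sum_sum_replaceBy t hb, avg,
    mul_div_mul_left _ _ (sub_pos.2 hN).ne']

theorem avg_eq_sum_sum_sdiff {t : ℕ} {A : Finset V} (hA : A.card < t) (h : Finset V → ℝ) :
    avg t A h = (∑ S ∈ supersets t A, ∑ _x ∈ S \ A, h S)
      / (((t : ℝ) - A.card) * (supersets t A).card) := by
  have hA' : (A.card : ℝ) < t := by exact_mod_cast hA
  have e : ∀ S ∈ supersets t A, ∑ _x ∈ S \ A, h S = ((t : ℝ) - A.card) * h S := by
    intro S hS
    obtain ⟨hS1, hS2⟩ := mem_supersets.1 hS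
    rw [Finset.sum_const, nsmul_eq_mul, Finset.card_sdiff_of_subset hS2,
      Nat.cast_sub (Finset.card_le_card hS2), hS1]
  rw [Finset.sum_congr rfl e, ← Finset.mul_sum, mul_div_mul_left _ _ (sub_pos.2 hA').ne', avg]

/-- The number of members of the family `F` contained in `S`. -/
def countIn (F : Finset (Finset V)) (S : Finset V) : ℕ := (F.filter fun B => B ⊆ S).card

/-- A swap can lose only members containing `x`, and gain only members containing `b` whose other
elements were already in `S`. -/
theorem abs_countIn_replaceBy_sub_le {U : Type*} [DecidableEq U] (F : Finset (Finset U))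
    (S : Finset U) (x b : U) :
    |(countIn F (replaceBy S x b) : ℝ) - countIn F S|
      ≤ (F.filter fun B => B ⊆ S ∧ x ∈ B).card
        + ((F.filter fun B => b ∈ B).filter fun B => B.erase b ⊆ S).card := by
  by_cases hb : b ∈ S
  · simp only [replaceBy, hb, if_true, sub_self, abs_zero]
    positivity
  have hrep : replaceBy S x b = insert b (S.erase x) := by simp [replaceBy, hb]
  have h1 : countIn F S ≤ countIn F (replaceBy S x b)
      + (F.filter fun B => B ⊆ S ∧ x ∈ B).card := by
    refine (Finset.card_le_card ?_).trans (Finset.card_union_le _ _)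
    intro B hB
    simp only [Finset.mem_union, Finset.mem_filter, hrep] at hB ⊢
    by_cases hx : x ∈ B
    · exact Or.inr ⟨hB.1, hB.2, hx⟩
    · refine Or.inl ⟨hB.1, fun a ha => Finset.mem_insert_of_mem (Finset.mem_erase.2 ⟨?_, hB.2 ha⟩)⟩
      rintro rfl
      exact hx ha
  have h2 : countIn F (replaceBy S x b) ≤ countIn F S
      + ((F.filter fun B => b ∈ B).filter fun B => B.erase b ⊆ S).card := by
    refine (Finset.card_le_card ?_).trans (Finset.card_union_le _ _)
    intro B hB
    simp only [Finset.mem_union, Finset.mem_filter, hrep] at hB ⊢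
    by_cases hbB : b ∈ B
    · refine Or.inr ⟨⟨hB.1, hbB⟩, fun a ha => ?_⟩
      obtain ⟨hab, haB⟩ := Finset.mem_erase.1 ha
      exact Finset.mem_of_mem_erase (Finset.mem_of_mem_insert_of_ne (hB.2 haB) hab)
    · refine Or.inl ⟨hB.1, fun a ha => ?_⟩
      have hab : a ≠ b := by rintro rfl; exact hbB ha
      exact Finset.mem_of_mem_erase (Finset.mem_of_mem_insert_of_ne (hB.2 ha) hab)
  have h1' : (countIn F S : ℝ) ≤ countIn F (replaceBy S x b)
      + (F.filter fun B => B ⊆ S ∧ x ∈ B).card := by exact_mod_cast h1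
  have h2' : (countIn F (replaceBy S x b) : ℝ) ≤ countIn F S
      + ((F.filter fun B => b ∈ B).filter fun B => B.erase b ⊆ S).card := by exact_mod_cast h2
  have p1 : (0 : ℝ) ≤ (F.filter fun B => B ⊆ S ∧ x ∈ B).card := Nat.cast_nonneg _
  have p2 : (0 : ℝ) ≤ ((F.filter fun B => b ∈ B).filter fun B => B.erase b ⊆ S).card :=
    Nat.cast_nonneg _
  rw [abs_le]
  constructor <;> linarith

theorem sum_card_filter_mem_le {U : Type*} [DecidableEq U] (F : Finset (Finset U)) {r : ℕ}
    (hF : ∀ B ∈ F, B.card = r) (S D : Finset U) :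
    ∑ x ∈ D, ((F.filter fun B => B ⊆ S ∧ x ∈ B).card : ℝ) ≤ r * countIn F S := by
  have e : ∀ x, (F.filter fun B => B ⊆ S ∧ x ∈ B)
      = (F.filter fun B => B ⊆ S).filter fun B => x ∈ B := fun x => by
    rw [Finset.filter_filter]
  simp only [e, Finset.card_filter _ (F.filter fun B => B ⊆ S)]
  push_cast
  rw [Finset.sum_comm, countIn, mul_comm, ← nsmul_eq_mul]
  refine Finset.sum_le_card_nsmul _ _ _ fun B hB => ?_
  rw [← Nat.cast_one, ← Nat.cast_zero]
  simp only [← Nat.cast_ite, ← Nat.cast_sum]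
  rw [← Finset.card_filter, ← hF B (Finset.mem_filter.1 hB).1]
  exact_mod_cast Finset.card_le_card fun x hx => (Finset.mem_filter.1 hx).2

theorem sum_card_filter_subset_le {t : ℕ} (ht : t ≤ Fintype.card V) (A : Finset V)
    (F : Finset (Finset V)) (q : Finset V → Finset V) :
    ∑ S ∈ supersets t A, ((F.filter fun B => q B ⊆ S).card : ℝ)
      ≤ (∑ B ∈ F, ((t : ℝ) / Fintype.card V) ^ (q B \ A).card) * (supersets t A).card := by
  simp only [Finset.card_filter]
  push_cast
  rw [Finset.sum_comm, Finset.sum_mul]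
  refine Finset.sum_le_sum fun B _ => ?_
  refine le_trans (le_of_eq ?_) (supersets_card_union_le ht A (q B))
  rw [← Nat.cast_one, ← Nat.cast_zero]
  simp only [← Nat.cast_ite, ← Nat.cast_sum]
  rw [← Finset.card_filter]
  congr 2
  ext S
  simp only [Finset.mem_filter, mem_supersets, Finset.union_subset_iff]
  tauto

end RandomSubset

/-! ### Stein's method for random sets of fixed size. -/

section RandomSubsetStein

variable {V : Type*} [Fintype V] [DecidableEq V]

/-- Forcing one more element `b` into the random set changes the mean of a Lipschitz function of
the number of members of `F` it contains only slightly. -/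
theorem abs_avg_insert_sub_le {t : ℕ} (ht : t ≤ Fintype.card V) {A B : Finset V} {b : V}
    (hb : b ∉ A) (hAB : insert b A ⊆ B) (hA : A.card < t) (F : Finset (Finset V)) {r : ℕ}
    (hF : ∀ B' ∈ F, B'.card = r) {γ G : ℝ}
    (hγ : ∑ B' ∈ F, ((t : ℝ) / Fintype.card V) ^ (B' \ B).card ≤ γ)
    (hG : ∑ B' ∈ F with b ∈ B', ((t : ℝ) / Fintype.card V) ^ (B' \ B).card ≤ G)
    {f : ℕ → ℝ} {K : ℝ} (hK : 0 ≤ K)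
    (hf : ∀ k l : ℕ, |f (k + 1) - f (l + 1)| ≤ K * |(k : ℝ) - l|) :
    |avg t (insert b A) (fun S => f (countIn F S + 1)) - avg t A (fun S => f (countIn F S + 1))|
      ≤ K * (r * γ / ((t : ℝ) - A.card) + G) := by
  set y : ℝ := (t : ℝ) / Fintype.card V with hy
  have hy0 : 0 ≤ y := by positivity
  have hy1 : y ≤ 1 := div_le_one_of_le₀ (by exact_mod_cast ht) (Nat.cast_nonneg _)
  have hA' : (0 : ℝ) < t - A.card := sub_pos.2 (by exact_mod_cast hA)
  have hc : (0 : ℝ) < (supersets t A).card := by exact_mod_cast supersets_card_pos hA.le ht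
  obtain ⟨hbB, hAB⟩ := Finset.insert_subset_iff.1 hAB
  rw [avg_insert ht hb hA, avg_eq_sum_sum_sdiff hA, ← sub_div, abs_div,
    abs_of_pos (mul_pos hA' hc), div_le_iff₀ (mul_pos hA' hc), ← Finset.sum_sub_distrib]
  simp only [← Finset.sum_sub_distrib]
  -- Since `A ⊆ B`, conditioning on `A` is bounded by the weights relative to `B`; so `γ` and `G`
  -- serve at every stage of the insertion.
  have hγ' : ∑ S ∈ supersets t A, (countIn F S : ℝ) ≤ γ * (supersets t A).card := by
    refine (sum_card_filter_subset_le ht A F id).trans ?_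
    refine mul_le_mul_of_nonneg_right (le_trans (Finset.sum_le_sum fun B' _ => ?_) hγ) hc.le
    exact pow_le_pow_of_le_one hy0 hy1 (Finset.card_le_card (Finset.sdiff_subset_sdiff le_rfl hAB))
  have hG' : ∑ S ∈ supersets t A,
      (((F.filter fun B' => b ∈ B').filter fun B' => B'.erase b ⊆ S).card : ℝ)
        ≤ G * (supersets t A).card := by
    refine (sum_card_filter_subset_le ht A _ fun B' => B'.erase b).trans ?_
    refine mul_le_mul_of_nonneg_right (le_trans (Finset.sum_le_sum fun B' _ => ?_) hG) hc.le
    refine pow_le_pow_of_le_one hy0 hy1 (Finset.card_le_card fun a ha => ?_)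
    rw [Finset.mem_sdiff] at ha ⊢
    refine ⟨Finset.mem_erase.2 ⟨?_, ha.1⟩, fun h => ha.2 (hAB h)⟩
    rintro rfl
    exact ha.2 hbB
  have hpt : ∀ S ∈ supersets t A,
      |∑ x ∈ S \ A, (f (countIn F (replaceBy S x b) + 1) - f (countIn F S + 1))|
        ≤ K * (r * countIn F S + ((t : ℝ) - A.card)
          * ((F.filter fun B' => b ∈ B').filter fun B' => B'.erase b ⊆ S).card) := by
    intro S hS
    obtain ⟨hS1, hS2⟩ := mem_supersets.1 hS
    refine (Finset.abs_sum_le_sum_abs _ _).trans ?_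
    have h1 : ∀ x ∈ S \ A, |f (countIn F (replaceBy S x b) + 1) - f (countIn F S + 1)|
        ≤ K * ((F.filter fun B => B ⊆ S ∧ x ∈ B).card
        + ((F.filter fun B => b ∈ B).filter fun B => B.erase b ⊆ S).card) := fun x _ =>
      (hf _ _).trans (mul_le_mul_of_nonneg_left (abs_countIn_replaceBy_sub_le F S x b) hK)
    refine (Finset.sum_le_sum h1).trans ?_
    rw [← Finset.mul_sum, Finset.sum_add_distrib, Finset.sum_const, nsmul_eq_mul,
      Finset.card_sdiff_of_subset hS2, Nat.cast_sub (Finset.card_le_card hS2), hS1]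
    have := sum_card_filter_mem_le F hF S (S \ A)
    gcongr
  refine (Finset.abs_sum_le_sum_abs _ _).trans ((Finset.sum_le_sum hpt).trans ?_)
  rw [← Finset.mul_sum, Finset.sum_add_distrib, ← Finset.mul_sum, ← Finset.mul_sum]
  have e : K * (r * γ / ((t : ℝ) - A.card) + G) * (((t : ℝ) - A.card) * (supersets t A).card)
      = K * (r * (γ * (supersets t A).card)
        + ((t : ℝ) - A.card) * (G * (supersets t A).card)) := by
    field_simp
  rw [e]
  gcongr

/-- Forcing the whole set `B` into the random set. -/
theorem abs_avg_sub_avg_empty_le {t : ℕ} (ht : t ≤ Fintype.card V) {B : Finset V}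
    (F : Finset (Finset V)) {r : ℕ} (hB : B.card = r) (hrt : r ≤ t)
    (hF : ∀ B' ∈ F, B'.card = r) {γ G : ℝ}
    (hγ : ∑ B' ∈ F, ((t : ℝ) / Fintype.card V) ^ (B' \ B).card ≤ γ)
    (hG : ∑ B' ∈ F with ¬ Disjoint B' B, ((t : ℝ) / Fintype.card V) ^ (B' \ B).card ≤ G)
    {f : ℕ → ℝ} {K : ℝ} (hK : 0 ≤ K)
    (hf : ∀ k l : ℕ, |f (k + 1) - f (l + 1)| ≤ K * |(k : ℝ) - l|) :
    |avg t B (fun S => f (countIn F S + 1)) - avg t ∅ (fun S => f (countIn F S + 1))|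
      ≤ r * (K * (r ^ 2 * γ / t + G)) := by
  have hγ0 : 0 ≤ γ := (Finset.sum_nonneg fun _ _ => by positivity).trans hγ
  have key : ∀ A : Finset V, A ⊆ B →
      |avg t A (fun S => f (countIn F S + 1)) - avg t ∅ (fun S => f (countIn F S + 1))|
        ≤ A.card * (K * (r ^ 2 * γ / t + G)) := by
    intro A
    induction A using Finset.induction_on with
    | empty => simp
    | insert b A hb ih =>
      intro hAB
      have hcard : A.card + 1 ≤ r := by
        rw [← Finset.card_insert_of_notMem hb, ← hB]
        exact Finset.card_le_card hAB
      have hbB : b ∈ B := hAB (Finset.mem_insert_self _ _)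
      have hGb : ∑ B' ∈ F with b ∈ B', ((t : ℝ) / Fintype.card V) ^ (B' \ B).card ≤ G := by
        refine le_trans (Finset.sum_le_sum_of_subset_of_nonneg ?_ fun _ _ _ => by positivity) hG
        intro B' hB'
        rw [Finset.mem_filter] at hB' ⊢
        exact ⟨hB'.1, Finset.not_disjoint_iff.2 ⟨b, hB'.2, hbB⟩⟩
      have h1 := abs_avg_insert_sub_le ht hb hAB (by omega) F hF hγ hGb hK hf
      have h2 := ih ((Finset.subset_insert _ _).trans hAB)
      have h3 := abs_sub_le (avg t (insert b A) (fun S => f (countIn F S + 1)))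
        (avg t A (fun S => f (countIn F S + 1))) (avg t ∅ (fun S => f (countIn F S + 1)))
      -- From `|A| ≤ r - 1` and `r ≤ t` follows `t ≤ r * (t - |A|)`.
      have h4 : r * γ / ((t : ℝ) - A.card) ≤ r ^ 2 * γ / t := by
        have hr : (A.card : ℝ) + 1 ≤ r := by exact_mod_cast hcard
        have hrt' : (r : ℝ) ≤ t := by exact_mod_cast hrt
        have hA0 : (0 : ℝ) ≤ A.card := Nat.cast_nonneg _
        rw [div_le_div_iff₀ (by linarith) (by linarith)]
        have : (t : ℝ) ≤ r * (t - A.card) := by nlinarith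
        calc r * γ * (t : ℝ) ≤ r * γ * (r * (t - A.card)) := by gcongr
          _ = _ := by ring
      have h5 : K * (r * γ / ((t : ℝ) - A.card) + G) ≤ K * (r ^ 2 * γ / t + G) := by gcongr
      rw [Finset.card_insert_of_notMem hb]
      push_cast
      linarith
  rw [← hB] at key ⊢
  exact key B le_rfl

theorem countIn_erase {U : Type*} [DecidableEq U] {F : Finset (Finset U)} {B : Finset U}
    (hB : B ∈ F) (S : Finset U) :
    countIn F S = countIn (F.erase B) S + if B ⊆ S then 1 else 0 := by
  unfold countIn
  conv_lhs => rw [← Finset.insert_erase hB]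
  rw [Finset.filter_insert]
  split_ifs with h
  · rw [Finset.card_insert_of_notMem (by simp)]
  · rfl

theorem abs_avg_le_of_forall {t : ℕ} {A : Finset V} {h h' : Finset V → ℝ}
    (hh : ∀ S ∈ supersets t A, |h S| ≤ h' S) : |avg t A h| ≤ avg t A h' := by
  rw [avg, avg, abs_div, Nat.abs_cast]
  exact div_le_div_of_nonneg_right
    ((Finset.abs_sum_le_sum_abs _ _).trans (Finset.sum_le_sum hh)) (Nat.cast_nonneg _)

theorem avg_sub (t : ℕ) (A : Finset V) (h h' : Finset V → ℝ) :
    avg t A h - avg t A h' = avg t A (fun S => h S - h' S) := by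
  rw [avg, avg, avg, Finset.sum_sub_distrib, sub_div]

/-- Probability that the random `t`-element set contains `B`. -/
noncomputable def containProb (t : ℕ) (B : Finset V) : ℝ :=
  (supersets t B).card / (supersets t (∅ : Finset V)).card

theorem containProb_nonneg (t : ℕ) (B : Finset V) : 0 ≤ containProb t B := by
  unfold containProb; positivity

theorem avg_ite_subset (t : ℕ) (B : Finset V) (h : Finset V → ℝ) :
    avg t ∅ (fun S => if B ⊆ S then h S else 0) = containProb t B * avg t B h := by
  have e : ∑ S ∈ supersets t ∅, (if B ⊆ S then h S else 0) = ∑ S ∈ supersets t B, h S := by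
    rw [← Finset.sum_filter]
    exact Finset.sum_congr (by ext S; simp) fun _ _ => rfl
  rw [avg, e, containProb, avg]
  rcases Nat.eq_zero_or_pos (supersets t B).card with h0 | h0
  · rw [Finset.card_eq_zero.1 h0]; simp
  · field_simp

theorem containProb_le {t : ℕ} (ht : t ≤ Fintype.card V) (B : Finset V) :
    containProb t B ≤ ((t : ℝ) / Fintype.card V) ^ B.card := by
  have h0 : (0 : ℝ) < (supersets t (∅ : Finset V)).card := by
    exact_mod_cast supersets_card_pos (by simp) ht
  rw [containProb, div_le_iff₀ h0]
  simpa using supersets_card_union_le ht ∅ B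

theorem le_containProb {t : ℕ} (ht0 : 0 < t) (ht : t ≤ Fintype.card V) (B : Finset V) :
    (1 - (B.card : ℝ) ^ 2 / t) * ((t : ℝ) / Fintype.card V) ^ B.card ≤ containProb t B := by
  have h0 : (0 : ℝ) < (supersets t (∅ : Finset V)).card := by
    exact_mod_cast supersets_card_pos (by simp) ht
  rw [containProb, le_div_iff₀ h0]
  exact le_supersets_card ht0 B

/-- Conditioning on `B` being contained in the random set, compared with adding one. -/
theorem abs_avg_countIn_sub_le {t : ℕ} (ht : t ≤ Fintype.card V) {F : Finset (Finset V)}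
    {B : Finset V} (hBF : B ∈ F) {r : ℕ} (hrt : r ≤ t) (hF : ∀ B' ∈ F, B'.card = r) {G : ℝ}
    (hG : ∑ B' ∈ F.erase B with ¬ Disjoint B' B, ((t : ℝ) / Fintype.card V) ^ (B' \ B).card ≤ G)
    {f : ℕ → ℝ} {K : ℝ} (hK : 0 ≤ K)
    (hf : ∀ k l : ℕ, |f (k + 1) - f (l + 1)| ≤ K * |(k : ℝ) - l|) :
    |avg t B (fun S => f (countIn F S)) - avg t ∅ (fun S => f (countIn F S + 1))|
      ≤ K * (r * (r ^ 2 * (F.card * ((t : ℝ) / Fintype.card V) ^ r + G) / t + G)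
        + ((t : ℝ) / Fintype.card V) ^ r) := by
  set y : ℝ := (t : ℝ) / Fintype.card V with hy
  have hy0 : 0 ≤ y := by positivity
  -- Members disjoint from `B` weigh `y ^ r` each; the others are controlled by `G`.
  have hγ : ∑ B' ∈ F.erase B, y ^ (B' \ B).card ≤ F.card * y ^ r + G := by
    rw [← Finset.sum_filter_add_sum_filter_not _ (fun B' => Disjoint B' B)]
    refine add_le_add ?_ hG
    have : ∀ B' ∈ (F.erase B).filter (fun B' => Disjoint B' B), y ^ (B' \ B).card = y ^ r := by
      intro B' hB'
      rw [Finset.mem_filter] at hB'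
      rw [Finset.sdiff_eq_self_of_disjoint hB'.2, hF _ (Finset.mem_of_mem_erase hB'.1)]
    rw [Finset.sum_congr rfl this, Finset.sum_const, nsmul_eq_mul]
    have : ((F.erase B).filter (fun B' => Disjoint B' B)).card ≤ F.card :=
      Finset.card_le_card ((Finset.filter_subset _ _).trans (Finset.erase_subset _ _))
    gcongr
  have h1 := abs_avg_sub_avg_empty_le ht (F.erase B) (hF B hBF) hrt
    (fun B' hB' => hF B' (Finset.mem_of_mem_erase hB')) hγ hG hK hf
  have h2 : avg t B (fun S => f (countIn F S))
      = avg t B (fun S => f (countIn (F.erase B) S + 1)) := by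
    unfold avg
    congr 1
    refine Finset.sum_congr rfl fun S hS => ?_
    simp only [countIn_erase hBF S, if_pos (mem_supersets.1 hS).2]
  -- Restoring `B` to the family matters only when `B ⊆ S`, an event of probability at most `y ^ r`.
  have h3 : |avg t ∅ (fun S => f (countIn (F.erase B) S + 1))
      - avg t ∅ (fun S => f (countIn F S + 1))| ≤ K * y ^ r := by
    rw [avg_sub]
    refine (abs_avg_le_of_forall (h' := fun S => if B ⊆ S then K else 0) fun S _ => ?_).trans ?_
    · refine (hf _ _).trans ?_
      rw [countIn_erase hBF S]
      split_ifs <;> simp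
    · rw [avg_ite_subset]
      have h0 : avg t B (fun _ => K) ≤ K := by
        rw [avg, Finset.sum_const, nsmul_eq_mul, mul_comm]
        exact div_le_of_le_mul₀ (Nat.cast_nonneg _) hK le_rfl
      have h4 := containProb_le ht B
      rw [hF B hBF] at h4
      rw [mul_comm]
      exact mul_le_mul h0 h4 (containProb_nonneg _ _) hK
  have h4 := abs_sub_le (avg t B (fun S => f (countIn F S)))
    (avg t ∅ (fun S => f (countIn (F.erase B) S + 1))) (avg t ∅ (fun S => f (countIn F S + 1)))
  rw [← h2] at h1
  linarith

/-- The size-bias identity: write the count as a sum of indicators and condition on each. -/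
theorem avg_countIn_mul (t : ℕ) (F : Finset (Finset V)) (f : ℕ → ℝ) :
    avg t ∅ (fun S => countIn F S * f (countIn F S))
      = ∑ B ∈ F, containProb t B * avg t B (fun S => f (countIn F S)) := by
  simp only [← avg_ite_subset]
  unfold avg
  rw [← Finset.sum_div, Finset.sum_comm]
  congr 1
  refine Finset.sum_congr rfl fun S _ => ?_
  rw [← Finset.sum_filter, Finset.sum_const, nsmul_eq_mul]
  rfl

/-- Poisson approximation for the number of members of `F` contained in a random `t`-element
set, at the exact mean. -/
theorem abs_avg_indicator_sub_poissonMeasure_le {t : ℕ} (ht : t ≤ Fintype.card V)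
    {F : Finset (Finset V)} {r : ℕ} (hF : ∀ B ∈ F, B.card = r) {G : ℝ}
    (hG0 : 0 ≤ G)
    (hG : ∀ B ∈ F, ∑ B' ∈ F.erase B with ¬ Disjoint B' B,
      ((t : ℝ) / Fintype.card V) ^ (B' \ B).card ≤ G) (A : Set ℕ) {μ : ℝ≥0}
    (hμ : (μ : ℝ) = ∑ B ∈ F, containProb t B) :
    |avg t ∅ (fun S => A.indicator 1 (countIn F S)) - (poissonMeasure μ).real A|
      ≤ r * (r ^ 2 * (F.card * ((t : ℝ) / Fintype.card V) ^ r + G) / t + G)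
        + ((t : ℝ) / Fintype.card V) ^ r := by
  have hc : (0 : ℝ) < (supersets t (∅ : Finset V)).card := by
    exact_mod_cast supersets_card_pos (by simp) ht
  -- Stein's equation needs a positive rate; at rate `0` both laws are the point mass at `0`.
  rcases eq_or_ne μ 0 with rfl | hμ0
  · have h0 : ∀ B ∈ F, containProb t B = 0 := by
      rw [NNReal.coe_zero, eq_comm, Finset.sum_eq_zero_iff_of_nonneg] at hμ
      · exact hμ
      · exact fun B _ => containProb_nonneg t B
    have hW : ∀ S ∈ supersets t (∅ : Finset V), countIn F S = 0 := by
      intro S hS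
      rw [countIn, Finset.card_eq_zero, Finset.filter_eq_empty_iff]
      intro B hB hBS
      have h := h0 B hB
      rw [containProb, div_eq_zero_iff, or_iff_left hc.ne', Nat.cast_eq_zero,
        Finset.card_eq_zero] at h
      have : S ∈ supersets t B := mem_supersets.2 ⟨(mem_supersets.1 hS).1, hBS⟩
      rw [h] at this
      simp at this
    have e1 : avg t ∅ (fun S => A.indicator (1 : ℕ → ℝ) (countIn F S)) = A.indicator 1 0 := by
      rw [avg, Finset.sum_congr rfl fun S hS => by rw [hW S hS], Finset.sum_const, nsmul_eq_mul]
      field_simp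
    have e2 : (poissonMeasure 0).real A = A.indicator 1 0 := by
      refine (hasSum_indicator_poissonMeasure 0 A).unique ?_
      convert hasSum_single 0 ?_ using 1
      · by_cases h : 0 ∈ A <;> simp [h, poissonMeasure_real_singleton]
      · intro k hk
        by_cases h : k ∈ A <;> simp [h, poissonMeasure_real_singleton, hk]
    rw [e1, e2, sub_self, abs_zero]
    positivity
  · have hμpos : 0 < μ := pos_iff_ne_zero.2 hμ0
    obtain ⟨f, hf1, hf2⟩ := exists_stein_solution hμpos A
    have hμpos' : (0 : ℝ) < μ := by exact_mod_cast hμpos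
    have hrt : r ≤ t := by
      by_contra h
      refine hμpos'.ne' (hμ.trans (Finset.sum_eq_zero fun B hB => ?_))
      have : supersets t B = ∅ := by
        rw [Finset.eq_empty_iff_forall_notMem]
        intro S hS
        obtain ⟨hS1, hS2⟩ := mem_supersets.1 hS
        have := Finset.card_le_card hS2
        rw [hF B hB] at this
        omega
      simp [containProb, this]
    have e1 : avg t ∅ (fun S => A.indicator 1 (countIn F S)) - (poissonMeasure μ).real A
        = μ * avg t ∅ (fun S => f (countIn F S + 1))
          - avg t ∅ (fun S => countIn F S * f (countIn F S)) := by
      have : (poissonMeasure μ).real A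
          = avg t (∅ : Finset V) (fun _ => (poissonMeasure μ).real A) := by
        rw [avg, Finset.sum_const, nsmul_eq_mul]
        field_simp
      rw [this, avg_sub]
      simp only [← hf1]
      rw [← avg_sub]
      congr 1
      rw [avg, avg, ← Finset.mul_sum, mul_div_assoc]
    rw [e1, avg_countIn_mul, hμ, Finset.sum_mul, ← Finset.sum_sub_distrib]
    simp only [← mul_sub]
    refine (Finset.abs_sum_le_sum_abs _ _).trans ?_
    refine (Finset.sum_le_sum (g := fun B => containProb t B * (1 / μ *
      (r * (r ^ 2 * (F.card * ((t : ℝ) / Fintype.card V) ^ r + G) / t + G)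
        + ((t : ℝ) / Fintype.card V) ^ r))) fun B hB => ?_).trans ?_
    · rw [abs_mul, abs_of_nonneg (containProb_nonneg t B), abs_sub_comm]
      exact mul_le_mul_of_nonneg_left
        (abs_avg_countIn_sub_le ht hB hrt hF (hG B hB) (by positivity) hf2)
        (containProb_nonneg t B)
    -- The containment probabilities sum to `μ` and cancel the Lipschitz constant `1 / μ`.
    · rw [← Finset.sum_mul, ← hμ, ← mul_assoc, mul_one_div_cancel hμpos'.ne', one_mul]

/-- Poisson approximation for the number of members of `F` contained in a random `t`-element
set. -/
theorem abs_avg_indicator_sub_poissonMeasure_le' {t : ℕ} (ht0 : 0 < t) (ht : t ≤ Fintype.card V)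
    {F : Finset (Finset V)} {r : ℕ} (hF : ∀ B ∈ F, B.card = r) {G : ℝ}
    (hG0 : 0 ≤ G)
    (hG : ∀ B ∈ F, ∑ B' ∈ F.erase B with ¬ Disjoint B' B,
      ((t : ℝ) / Fintype.card V) ^ (B' \ B).card ≤ G) (A : Set ℕ) {l : ℝ≥0}
    (hl : (l : ℝ) = F.card * ((t : ℝ) / Fintype.card V) ^ r) :
    |avg t ∅ (fun S => A.indicator 1 (countIn F S)) - (poissonMeasure l).real A|
      ≤ r * (r ^ 2 * (l + G) / t + G) + ((t : ℝ) / Fintype.card V) ^ r + r ^ 2 * l / t := by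
  set y : ℝ := (t : ℝ) / Fintype.card V with hy
  have hμ0 : 0 ≤ ∑ B ∈ F, containProb t B := Finset.sum_nonneg fun B _ => containProb_nonneg t B
  let μ : ℝ≥0 := ⟨∑ B ∈ F, containProb t B, hμ0⟩
  have hμ : (μ : ℝ) = ∑ B ∈ F, containProb t B := rfl
  have h1 := abs_avg_indicator_sub_poissonMeasure_le ht hF hG0 hG A hμ
  rw [← hy, ← hl] at h1
  have h2 := abs_poissonMeasure_real_sub_le μ l A
  have h3 : |(μ : ℝ) - l| ≤ r ^ 2 * l / t := by
    have u1 : (μ : ℝ) ≤ l := by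
      rw [hμ, hl, ← nsmul_eq_mul, ← Finset.sum_const]
      exact Finset.sum_le_sum fun B hB => by
        have := containProb_le ht B
        rwa [hF B hB] at this
    have u2 : (1 - (r : ℝ) ^ 2 / t) * l ≤ μ := by
      rw [hμ, hl, mul_left_comm, ← nsmul_eq_mul, ← Finset.sum_const]
      exact Finset.sum_le_sum fun B hB => by
        have := le_containProb ht0 ht B
        rwa [hF B hB] at this
    rw [abs_sub_comm, abs_of_nonneg (sub_nonneg.2 u1)]
    have : (1 - (r : ℝ) ^ 2 / t) * l = l - r ^ 2 * l / t := by ring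
    linarith
  have h4 := abs_sub_le (avg t ∅ (fun S => A.indicator 1 (countIn F S)))
    ((poissonMeasure μ).real A) ((poissonMeasure l).real A)
  linarith

end RandomSubsetStein

/-! ### From shuffled decks to random sets of cards -/

theorem exists_perm_comp_eq {V ι : Type*} [Fintype V] [DecidableEq ι] {f g : V → ι}
    (h : ∀ i, (Finset.univ.filter fun s => f s = i).card
      = (Finset.univ.filter fun s => g s = i).card) :
    ∃ σ : Equiv.Perm V, f ∘ σ = g := by
  have e : ∀ i, Nonempty ({s // g s = i} ≃ {s // f s = i}) := fun i => by
    rw [← Fintype.card_eq, Fintype.card_subtype, Fintype.card_subtype, h]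
  refine ⟨(Equiv.sigmaFiberEquiv g).symm.trans ((Equiv.sigmaCongrRight fun i => (e i).some).trans
    (Equiv.sigmaFiberEquiv f)), funext fun s => ?_⟩
  exact ((e (g s)).some ⟨s, rfl⟩).2

theorem exists_perm_map_eq {V : Type*} [Fintype V] [DecidableEq V] {S T : Finset V}
    (h : S.card = T.card) : ∃ σ : Equiv.Perm V, S.map σ.toEmbedding = T := by
  obtain ⟨σ, hσ⟩ := exists_perm_comp_eq (f := fun x => decide (x ∈ T))
    (g := fun x => decide (x ∈ S)) (fun i => by
      cases i
      · simp [Finset.filter_not, Finset.card_sdiff, h]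
      · simp [h])
  refine ⟨σ, Finset.ext fun x => ?_⟩
  have := congrFun hσ (σ.symm x)
  simp only [Function.comp_apply, Equiv.apply_symm_apply, decide_eq_decide] at this
  rw [this, Finset.mem_map_equiv]

/-- The `r`-element sets of positions which carry cards of the same type. -/
def monochromatic {V ι : Type*} [Fintype V] [DecidableEq V] [DecidableEq ι] (z : V → ι) (r : ℕ) :
    Finset (Finset V) :=
  Finset.univ.filter fun B => B.card = r ∧ ∀ a ∈ B, ∀ b ∈ B, z a = z b

/-! ### Counting and clustering of monochromatic sets. -/

section Monochromatic

variable {V ι : Type*} [Fintype V] [DecidableEq V] [DecidableEq ι]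

@[simp] theorem mem_monochromatic {z : V → ι} {r : ℕ} {B : Finset V} :
    B ∈ monochromatic z r ↔ B.card = r ∧ ∀ a ∈ B, ∀ b ∈ B, z a = z b := by
  simp [monochromatic]

theorem countIn_monochromatic_comp (z : V → ι) (r : ℕ) (σ : Equiv.Perm V) (S : Finset V) :
    countIn (monochromatic (z ∘ σ) r) S
      = countIn (monochromatic z r) (S.map σ.toEmbedding) := by
  unfold countIn
  refine Finset.card_bij (fun B _ => B.map σ.toEmbedding) ?_ ?_ ?_
  · intro B hB
    simp only [Finset.mem_filter, mem_monochromatic, Finset.card_map, Finset.forall_mem_map,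
      Finset.map_subset_map] at hB ⊢
    exact hB
  · intro B _ B' _ h
    exact Finset.map_injective _ h
  · intro B hB
    refine ⟨B.map σ.symm.toEmbedding, ?_, ?_⟩
    · simp only [Finset.mem_filter, mem_monochromatic, Finset.card_map, Finset.forall_mem_map,
        Function.comp_apply, Equiv.coe_toEmbedding, Equiv.apply_symm_apply] at hB ⊢
      refine ⟨hB.1, fun x hx => ?_⟩
      obtain ⟨b, hb, rfl⟩ := Finset.mem_map.1 hx
      have := hB.2 hb
      rw [Finset.mem_map_equiv] at this
      exact this
    · ext x
      simp [Finset.mem_map_equiv]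

/-- For `r > 0` a monochromatic set determines its type, so the sets split disjointly by type. -/
theorem card_monochromatic [Fintype ι] (z : V → ι) {r : ℕ} (hr : 0 < r) :
    (monochromatic z r).card
      = ∑ i, ((Finset.univ.filter fun s => z s = i).card).choose r := by
  have h : monochromatic z r
      = Finset.univ.biUnion fun i => (Finset.univ.filter fun s => z s = i).powersetCard r := by
    ext B
    simp only [mem_monochromatic, Finset.mem_biUnion, Finset.mem_univ, true_and,
      Finset.mem_powersetCard, Finset.subset_iff, Finset.mem_filter]
    constructor
    · rintro ⟨h1, h2⟩
      obtain ⟨a, ha⟩ := Finset.card_pos.1 (h1 ▸ hr)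
      exact ⟨z a, fun x hx => h2 x hx a ha, h1⟩
    · rintro ⟨i, h1, h2⟩
      exact ⟨h2, fun a ha b hb => (h1 ha).trans (h1 hb).symm⟩
  rw [h, Finset.card_biUnion]
  · simp
  · intro i _ i' _ hii
    refine Finset.disjoint_left.2 fun B hB hB' => ?_
    rw [Finset.mem_powersetCard] at hB hB'
    obtain ⟨a, ha⟩ := Finset.card_pos.1 (hB.2 ▸ hr)
    exact hii ((Finset.mem_filter.1 (hB.1 ha)).2.symm.trans (Finset.mem_filter.1 (hB'.1 ha)).2)

theorem sum_powerset_erase_empty_pow_card {U : Type*} [DecidableEq U] (y : ℝ) (S : Finset U) :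
    ∑ Q ∈ S.powerset.erase ∅, y ^ Q.card = (1 + y) ^ S.card - 1 := by
  have h := Finset.sum_pow_mul_eq_add_pow y 1 S
  simp only [one_pow, mul_one] at h
  rw [eq_sub_iff_add_eq, add_comm 1 y, ← h]
  simpa only [Finset.card_empty, pow_zero] using
    Finset.sum_erase_add S.powerset (fun Q => y ^ Q.card) (Finset.empty_mem_powerset S)

/-- Encode `B'` by `(B' ∩ B, B' \ B)`. The first part is one of `2 ^ r` subsets of `B`. The second
lies in the colour class of `B`, because `B'` meets `B`, and is nonempty, because `B' ≠ B` has the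
same size; hence the `- 1`. -/
theorem sum_monochromatic_not_disjoint_le {y : ℝ} (hy : 0 ≤ y) {z : V → ι} {r M : ℕ}
    (hM : ∀ i, (Finset.univ.filter fun s => z s = i).card ≤ M) {B : Finset V}
    (hB : B ∈ monochromatic z r) :
    ∑ B' ∈ (monochromatic z r).erase B with ¬ Disjoint B' B, y ^ (B' \ B).card
      ≤ 2 ^ r * ((1 + y) ^ M - 1) := by
  obtain ⟨hBr, hBz⟩ := mem_monochromatic.1 hB
  have h1M : 0 ≤ (1 + y) ^ M - 1 := sub_nonneg.2 (one_le_pow₀ (by linarith))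
  rcases B.eq_empty_or_nonempty with rfl | ⟨b, hb⟩
  · simp only [Finset.disjoint_empty_right, not_true_eq_false, Finset.filter_false,
      Finset.sum_empty]
    positivity
  let C : Finset V := Finset.univ.filter fun s => z s = z b
  have h1 : ∑ B' ∈ (monochromatic z r).erase B with ¬ Disjoint B' B, y ^ (B' \ B).card
      ≤ ∑ P ∈ B.powerset ×ˢ C.powerset.erase ∅, y ^ P.2.card := by
    rw [← Finset.sum_image (f := fun P : Finset V × Finset V => y ^ P.2.card)
      (g := fun B' => (B' ∩ B, B' \ B))]
    · refine Finset.sum_le_sum_of_subset_of_nonneg ?_ fun _ _ _ => by positivity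
      intro P hP
      obtain ⟨B', hB', rfl⟩ := Finset.mem_image.1 hP
      simp only [Finset.mem_filter, Finset.mem_erase, mem_monochromatic] at hB'
      obtain ⟨⟨hne, hr, hz⟩, hd⟩ := hB'
      obtain ⟨a, ha, haB⟩ := Finset.not_disjoint_iff.1 hd
      simp only [Finset.mem_product, Finset.mem_powerset, Finset.mem_erase]
      refine ⟨Finset.inter_subset_right, ?_, fun x hx => ?_⟩
      · rw [Ne, Finset.sdiff_eq_empty_iff_subset]
        exact fun h => hne (Finset.eq_of_subset_of_card_le h (by rw [hBr, hr]))
      · refine Finset.mem_filter.2 ⟨Finset.mem_univ _, ?_⟩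
        exact (hz x (Finset.mem_sdiff.1 hx).1 a ha).trans (hBz a haB b hb)
    · intro B₁ _ B₂ _ h
      simp only [Prod.mk.injEq] at h
      rw [← Finset.sdiff_union_inter B₁ B, ← Finset.sdiff_union_inter B₂ B, h.1, h.2]
  refine h1.trans ?_
  rw [Finset.sum_product]
  simp only
  rw [Finset.sum_const, sum_powerset_erase_empty_pow_card, Finset.card_powerset, hBr, nsmul_eq_mul]
  push_cast
  have : (1 + y) ^ C.card ≤ (1 + y) ^ M := pow_le_pow_right₀ (by linarith) (hM (z b))
  gcongr

end Monochromatic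

/-- The decks with multiplicities `m`, as a finite set. -/
def decksFinset {n : ℕ} (m : Fin n → ℕ) : Finset (Fin (size m) → Fin n) :=
  Finset.univ.filter fun z => ∀ i, (Finset.univ.filter fun s => z s = i).card = m i

theorem coe_decksFinset {n : ℕ} (m : Fin n → ℕ) : (decksFinset m : Set _) = decks m := by
  ext z
  simp [decksFinset, decks]

theorem mem_decksFinset {n : ℕ} {m : Fin n → ℕ} {z : Fin (size m) → Fin n} :
    z ∈ decksFinset m ↔ ∀ i, (Finset.univ.filter fun s => z s = i).card = m i := by
  simp [decksFinset]

theorem comp_mem_decksFinset {n : ℕ} {m : Fin n → ℕ} {z : Fin (size m) → Fin n}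
    (σ : Equiv.Perm (Fin (size m))) : z ∘ σ ∈ decksFinset m ↔ z ∈ decksFinset m := by
  simp only [mem_decksFinset]
  refine forall_congr' fun i => ?_
  have : (Finset.univ.filter fun s => z s = i).card
      = (Finset.univ.filter fun s => (z ∘ σ) s = i).card := by
    refine Finset.card_bij (fun s _ => σ.symm s) ?_ ?_ ?_
    · simp
    · simp
    · intro s hs
      exact ⟨σ s, by simpa using hs, by simp⟩
  rw [this]

/-- For a given number of positions, a random deck and a random set of positions of a fixed deck
give the same count of monochromatic sets in law. -/
theorem sum_decks_mul_card_supersets {n : ℕ} {m : Fin n → ℕ} {z₀ : Fin (size m) → Fin n}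
    (hz₀ : z₀ ∈ decksFinset m) {t r : ℕ} {T : Finset (Fin (size m))} (hT : T.card = t)
    (H : ℕ → ℝ) :
    (supersets t (∅ : Finset (Fin (size m)))).card
        * ∑ z ∈ decksFinset m, H (countIn (monochromatic z r) T)
      = (decksFinset m).card
        * ∑ S ∈ supersets t ∅, H (countIn (monochromatic z₀ r) S) := by
  -- Both sides equal the double sum over decks and position sets: permuting positions makes the sum
  -- over decks independent of `S`, and the sum over `S` independent of the deck.
  have h1 : ∀ S ∈ supersets t (∅ : Finset (Fin (size m))),
      ∑ z ∈ decksFinset m, H (countIn (monochromatic z r) S)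
        = ∑ z ∈ decksFinset m, H (countIn (monochromatic z r) T) := by
    intro S hS
    obtain ⟨σ, hσ⟩ := exists_perm_map_eq (hT.trans (mem_supersets.1 hS).1.symm)
    refine Finset.sum_bij' (fun z _ => z ∘ σ) (fun z _ => z ∘ σ.symm) ?_ ?_ ?_ ?_ ?_
    · exact fun z hz => (comp_mem_decksFinset σ).2 hz
    · exact fun z hz => (comp_mem_decksFinset σ.symm).2 hz
    · exact fun z _ => by ext; simp
    · exact fun z _ => by ext; simp
    · exact fun z _ => by rw [countIn_monochromatic_comp, hσ]
  have h2 : ∀ z ∈ decksFinset m,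
      ∑ S ∈ supersets t ∅, H (countIn (monochromatic z r) S)
        = ∑ S ∈ supersets t ∅, H (countIn (monochromatic z₀ r) S) := by
    intro z hz
    obtain ⟨σ, hσ⟩ := exists_perm_comp_eq (f := z₀) (g := z) fun i => by
      rw [mem_decksFinset.1 hz, mem_decksFinset.1 hz₀]
    refine Finset.sum_bij' (fun S _ => S.map σ.toEmbedding) (fun S _ => S.map σ.symm.toEmbedding)
      ?_ ?_ ?_ ?_ ?_
    · intro S hS
      simpa using hS
    · intro S hS
      simpa using hS
    · intro S _
      ext; simp [Finset.mem_map_equiv]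
    · intro S _
      ext; simp [Finset.mem_map_equiv]
    · intro S _
      rw [← hσ, countIn_monochromatic_comp]
  calc _ = ∑ S ∈ supersets t (∅ : Finset (Fin (size m))),
        ∑ z ∈ decksFinset m, H (countIn (monochromatic z r) S) := by
        rw [Finset.sum_congr rfl h1, Finset.sum_const, nsmul_eq_mul]
    _ = _ := by
        rw [Finset.sum_comm, Finset.sum_congr rfl h2, Finset.sum_const, nsmul_eq_mul]

theorem W_eq_countIn {n N : ℕ} (j t : ℕ) (z : Fin N → Fin n) :
    W j t z = countIn (monochromatic z (j + 1)) (Finset.univ.filter fun a => (a : ℕ) < t) := by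
  unfold W countIn
  congr 1
  ext B
  simp only [Finset.mem_filter, Finset.mem_univ, true_and, mem_monochromatic, Finset.subset_iff]
  tauto

theorem lawW_real_eq_avg {n : ℕ} {m : Fin n → ℕ} {z₀ : Fin (size m) → Fin n}
    (hz₀ : z₀ ∈ decksFinset m) (j : ℕ) {t : ℕ} (ht : t ≤ size m) (A : Set ℕ) :
    (lawW m j t).real A
      = avg t ∅ (fun S => A.indicator 1 (countIn (monochromatic z₀ (j + 1)) S)) := by
  classical
  set T : Finset (Fin (size m)) := Finset.univ.filter fun a => (a : ℕ) < t with hTdef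
  have hT : T.card = t := by
    rw [hTdef, Fin.card_filter_val_lt]
    exact min_eq_right ht
  have hD : (0 : ℝ) < (decksFinset m).card := by exact_mod_cast Finset.card_pos.2 ⟨z₀, hz₀⟩
  have hc : (0 : ℝ) < (supersets t (∅ : Finset (Fin (size m)))).card := by
    exact_mod_cast supersets_card_pos (by simp) (by simpa using ht)
  have h := sum_decks_mul_card_supersets hz₀ (r := j + 1) hT (A.indicator 1)
  have h1 : (lawW m j t).real A
      = (∑ z ∈ decksFinset m, A.indicator 1 (countIn (monochromatic z (j + 1)) T))
        / (decksFinset m).card := by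
    let Z : Finset (Fin (size m) → Fin n) := Finset.univ.filter fun z => W j t z ∈ A
    have e : W j t ⁻¹' A = (Z : Set (Fin (size m) → Fin n)) := by
      ext z; simp [Z]
    rw [measureReal_def, lawW, Measure.map_apply (measurable_of_finite _) MeasurableSet.of_discrete,
      shuffledDeck, ← coe_decksFinset, e, uniformOn_apply_finset, ENNReal.toReal_div,
      ENNReal.toReal_natCast, ENNReal.toReal_natCast, Finset.inter_filter, Finset.inter_univ,
      Finset.card_filter]
    push_cast
    congr 1
    refine Finset.sum_congr rfl fun z _ => ?_
    rw [W_eq_countIn, Set.indicator_apply]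
    rfl
  rw [h1, avg, div_eq_div_iff hD.ne' hc.ne']
  linarith

/-! ### Total variation estimates for decks. -/

theorem tvDist_le {Ω : Type*} [MeasurableSpace Ω] {μ ν : Measure Ω} {c : ℝ}
    (h : ∀ A, MeasurableSet A → |μ.real A - ν.real A| ≤ c) : tvDist μ ν ≤ c := by
  have : Nonempty {A : Set Ω // MeasurableSet A} := ⟨⟨∅, MeasurableSet.empty⟩⟩
  exact ciSup_le fun A => h A.1 A.2

theorem tvDist_le_one {Ω : Type*} [MeasurableSpace Ω] (μ ν : Measure Ω) [IsProbabilityMeasure μ]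
    [IsProbabilityMeasure ν] : tvDist μ ν ≤ 1 := by
  refine tvDist_le fun A _ => ?_
  have h1 : μ.real A ≤ 1 := measureReal_le_one
  have h2 : ν.real A ≤ 1 := measureReal_le_one
  have h3 : 0 ≤ μ.real A := measureReal_nonneg
  have h4 : 0 ≤ ν.real A := measureReal_nonneg
  rw [abs_le]
  constructor <;> linarith

/-- The powers of `n` cancel: `λ` is the number of monochromatic `(j + 1)`-sets times `(t / N) ^ (j
+ 1)`, the mean if positions were chosen independently. -/
theorem poisson_rate_eq {n : ℕ} (m : Fin n → ℕ) (hn : n ≠ 0) (hN : size m ≠ 0) (j t : ℕ) :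
    (((t : ℝ≥0) ^ (j + 1) / (n : ℝ≥0) ^ j * beta m (j + 1) : ℝ≥0) : ℝ)
      = (∑ i, (m i).choose (j + 1) : ℕ) * ((t : ℝ) / size m) ^ (j + 1) := by
  have hn' : (n : ℝ) ≠ 0 := by exact_mod_cast hn
  have hN' : (size m : ℝ) ≠ 0 := by exact_mod_cast hN
  rw [beta, avgMult, ← Finset.mul_sum]
  push_cast
  rw [div_pow, div_pow, pow_succ (n : ℝ)]
  field_simp

theorem one_add_pow_sub_one_le {y : ℝ} (hy : 0 ≤ y) (M : ℕ) :
    (1 + y) ^ M - 1 ≤ M * y * Real.exp (M * y) := by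
  have h1 : (1 + y) ^ M ≤ Real.exp (M * y) := by
    rw [Real.exp_nat_mul]
    exact pow_le_pow_left₀ (by linarith) (by linarith [Real.add_one_le_exp y]) M
  have h2 := Real.add_one_le_exp (-(M * y))
  have h3 := Real.exp_pos (M * y)
  have h4 : Real.exp (M * y) * Real.exp (-(M * y)) = 1 := by rw [← Real.exp_add]; simp
  nlinarith

/-- The error bound when at most as many cards are drawn as there are types. -/
theorem tvDist_lawW_le {n : ℕ} {m : Fin n → ℕ} {j t : ℕ} (hj : 1 ≤ j) {ε : ℝ} (hε : 0 < ε)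
    (hm : 1 ≤ maxMult m) (ht0 : 1 ≤ t) (htN : t ≤ size m) (htn : t ≤ n)
    (havg : ε * (maxMult m : ℝ) ≤ (avgMult m : ℝ)) {g L : ℝ}
    (hg : g = 2 ^ (j + 1) * (1 / ε * Real.exp (1 / ε))) (hL : L = (1 / ε) ^ (j + 1)) :
    tvDist (lawW m j t)
        (poissonMeasure ((t : ℝ≥0) ^ (j + 1) / (n : ℝ≥0) ^ j * beta m (j + 1)))
      ≤ (((j + 1 : ℕ) : ℝ) * (((j + 1 : ℕ) : ℝ) ^ 2 * (L + g) + g) + 1 / ε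
          + ((j + 1 : ℕ) : ℝ) ^ 2 * L) * ((t : ℝ) / n) := by
  have ht0' : (1 : ℝ) ≤ t := by exact_mod_cast ht0
  have hn : 0 < n := by omega
  have hn' : (0 : ℝ) < n := by exact_mod_cast hn
  have hN : 0 < size m := by omega
  have hN' : (0 : ℝ) < size m := by exact_mod_cast hN
  set x : ℝ := (t : ℝ) / n with hx
  set y : ℝ := (t : ℝ) / size m with hy
  set M : ℕ := maxMult m with hMdef
  have hx0 : 0 < x := by positivity
  have hx1 : x ≤ 1 := div_le_one_of_le₀ (by exact_mod_cast htn) hn'.le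
  have hy0 : 0 ≤ y := by positivity
  have hy1 : y ≤ 1 := div_le_one_of_le₀ (by exact_mod_cast htN) hN'.le
  have hm' : (1 : ℝ) ≤ M := by exact_mod_cast hm
  have hmM : ∀ i, m i ≤ M := fun i => Finset.le_sup (Finset.mem_univ i)
  have hMy : M * y ≤ 1 / ε * x := by
    rw [avgMult] at havg
    push_cast at havg
    rw [le_div_iff₀ hn'] at havg
    rw [hx, hy, mul_div_assoc', div_mul_div_comm, one_mul, div_le_div_iff₀ hN' (by positivity)]
    nlinarith
  have hMy1 : M * y ≤ 1 / ε := hMy.trans (mul_le_of_le_one_right (by positivity) hx1)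
  have hyx : y ≤ 1 / ε * x := (le_mul_of_one_le_left hy0 hm').trans hMy
  obtain ⟨z₀, hz₀⟩ := decks_nonempty m
  rw [← coe_decksFinset, Finset.mem_coe] at hz₀
  have hz₀' := mem_decksFinset.1 hz₀
  set l : ℝ≥0 := (t : ℝ≥0) ^ (j + 1) / (n : ℝ≥0) ^ j * beta m (j + 1) with hldef
  have hl := poisson_rate_eq m hn.ne' hN.ne' j t
  rw [← hldef, ← hy] at hl
  have hcard : (monochromatic z₀ (j + 1)).card = ∑ i, (m i).choose (j + 1) := by
    rw [card_monochromatic z₀ (Nat.succ_pos j)]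
    simp only [hz₀']
  -- The rate is at most `n * (x / ε) ^ (j + 1)`. As `n * x = t`, dividing by `t` leaves `L * x ^
  -- j`, and `x ^ j ≤ x` because `j ≥ 1` and `x ≤ 1`.
  have hlle : (l : ℝ) / t ≤ L * x := by
    have h1 : ((∑ i, (m i).choose (j + 1) : ℕ) : ℝ) ≤ n * (M : ℝ) ^ (j + 1) := by
      have : ∑ i, (m i).choose (j + 1) ≤ n * M ^ (j + 1) := by
        refine (Finset.sum_le_card_nsmul Finset.univ _ (M ^ (j + 1)) fun i _ => ?_).trans ?_
        · exact (Nat.choose_le_pow _ _).trans (Nat.pow_le_pow_left (hmM i) _)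
        · simp
      exact_mod_cast this
    have h2 : (l : ℝ) ≤ n * (1 / ε * x) ^ (j + 1) := by
      rw [hl]
      calc _ ≤ n * (M : ℝ) ^ (j + 1) * y ^ (j + 1) := by gcongr
        _ = n * (M * y) ^ (j + 1) := by rw [mul_pow]; ring
        _ ≤ _ := by gcongr
    have h3 : x ^ j ≤ x := by
      calc x ^ j ≤ x ^ 1 := pow_le_pow_of_le_one hx0.le hx1 hj
        _ = x := pow_one x
    have hL0 : 0 ≤ L := by rw [hL]; positivity
    calc (l : ℝ) / t ≤ n * (1 / ε * x) ^ (j + 1) / t := by gcongr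
      _ = L * x ^ j := by
        rw [hL, mul_pow, pow_succ x, hx]
        field_simp
      _ ≤ L * x := by gcongr
  set G : ℝ := g * x with hG
  have hg0 : 0 ≤ g := by rw [hg]; positivity
  have hG0 : 0 ≤ G := mul_nonneg hg0 hx0.le
  have hGB : ∀ B ∈ monochromatic z₀ (j + 1),
      ∑ B' ∈ (monochromatic z₀ (j + 1)).erase B with ¬ Disjoint B' B,
        ((t : ℝ) / Fintype.card (Fin (size m))) ^ (B' \ B).card ≤ G := by
    intro B hB
    rw [Fintype.card_fin, ← hy]
    refine (sum_monochromatic_not_disjoint_le hy0 (M := M)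
      (fun i => (hz₀' i).trans_le (hmM i)) hB).trans ?_
    have h1 : (1 + y) ^ M - 1 ≤ 1 / ε * x * Real.exp (1 / ε) := by
      refine (one_add_pow_sub_one_le hy0 M).trans ?_
      gcongr
    calc (2 : ℝ) ^ (j + 1) * ((1 + y) ^ M - 1)
        ≤ 2 ^ (j + 1) * (1 / ε * x * Real.exp (1 / ε)) := by gcongr
      _ = G := by rw [hG, hg]; ring
  refine tvDist_le fun A _ => ?_
  rw [lawW_real_eq_avg hz₀ j htN]
  have key := abs_avg_indicator_sub_poissonMeasure_le' (r := j + 1) ht0 (by simpa using htN)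
    (fun B hB => (mem_monochromatic.1 hB).1) hG0 hGB A (l := l)
    (by rw [hl, hcard, Fintype.card_fin])
  rw [Fintype.card_fin, ← hy] at key
  refine key.trans ?_
  set r : ℝ := ((j + 1 : ℕ) : ℝ) with hr
  have hr0 : 0 ≤ r := Nat.cast_nonneg _
  have h1 : y ^ (j + 1) ≤ 1 / ε * x := by
    calc y ^ (j + 1) ≤ y ^ 1 := pow_le_pow_of_le_one hy0 hy1 (by omega)
      _ = y := pow_one y
      _ ≤ _ := hyx
  have h2 : G / t ≤ G := div_le_self hG0 ht0'
  have h3 : r ^ 2 * (l + G) / t ≤ r ^ 2 * (L * x + G) := by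
    rw [mul_div_assoc, add_div]
    gcongr
  have h4 : r ^ 2 * l / t ≤ r ^ 2 * (L * x) := by
    rw [mul_div_assoc]
    gcongr
  calc r * (r ^ 2 * (l + G) / t + G) + y ^ (j + 1) + r ^ 2 * l / t
      ≤ r * (r ^ 2 * (L * x + G) + G) + 1 / ε * x + r ^ 2 * (L * x) := by gcongr
    _ = _ := by rw [hG]; ring

end CardDeck

theorem mainTheorem1 (j : ℕ) (hj : 1 ≤ j) (ε : ℝ) (hε : 0 < ε) :
    ∃ C : ℝ, ∀ (n : ℕ) (m : Fin n → ℕ) (t : ℕ),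
      j ≤ CardDeck.maxMult m - 1 → 1 ≤ t → t ≤ CardDeck.size m →
      ε * (CardDeck.maxMult m : ℝ) ≤ (CardDeck.avgMult m : ℝ) →
      (ε ≤ CardDeck.cardFraction m (min (2 * j + 1) (CardDeck.maxMult m)) ∨
        ε ≤ CardDeck.typeFraction m (min (2 * j + 1) (CardDeck.maxMult m))) →
      CardDeck.tvDist (CardDeck.lawW m j t)
          (poissonMeasure
            ((t : ℝ≥0) ^ (j + 1) / (n : ℝ≥0) ^ j * CardDeck.beta m (j + 1)))
        ≤ C * ((t : ℝ) / (n : ℝ)) := by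
  set g : ℝ := 2 ^ (j + 1) * (1 / ε * Real.exp (1 / ε)) with hg
  set L : ℝ := (1 / ε) ^ (j + 1) with hL
  -- The `1` covers `t > n`, where the bound exceeds the trivial one.
  refine ⟨max 1 (((j + 1 : ℕ) : ℝ) * (((j + 1 : ℕ) : ℝ) ^ 2 * (L + g) + g) + 1 / ε
    + ((j + 1 : ℕ) : ℝ) ^ 2 * L), fun n m t hjm ht0 htN havg _ => ?_⟩
  rcases le_or_gt t n with htn | htn
  · refine (CardDeck.tvDist_lawW_le hj hε (by omega) ht0 htN htn havg hg hL).trans ?_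
    gcongr
    exact le_max_right _ _
  · have hn : 0 < n := by
      rcases Nat.eq_zero_or_pos n with rfl | hn
      · simp [CardDeck.maxMult] at hjm
        omega
      · exact hn
    have h1 : (1 : ℝ) ≤ (t : ℝ) / n := by
      rw [one_le_div (by exact_mod_cast hn)]
      exact_mod_cast htn.le
    calc _ ≤ (1 : ℝ) := CardDeck.tvDist_le_one _ _
      _ ≤ 1 * ((t : ℝ) / n) := by linarith
      _ ≤ _ := by gcongr; exact le_max_left _ _
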